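/- All graphs are finite and simple. Let $P(G,t)$ denote the chromatic polynomial of a graph $G$, i.e. the polynomial whose value at each non-negative integer $n$ is the number of proper $n$-colourings of $G$. The double subdivision of an edge $uv$ of $G$ deletes $uv$, adds two new vertices, and joins both of them to $u$ and to $v$. A generalised triangle is either $K_3$ or any graph obtained from $K_3$ by a sequence of double subdivisions. A $2$-cut of $G$ is a pair of distinct vertices $\{x,y\}$ whose removal increases the number of connected components; its $\{x,y\}$-bridges are the induced subgraphs $G[V(C)\cup\{x,y\}]$, where $C$ ranges over the components of $G-\{x,y\}$, and a bridge is trivial if it has exactly three vertices. Let $\mathcal{K}_2$ be the class of generalised triangles $G$ such that every $2$-cut $\{x,y\}$ of $G$ has at least one trivial $\{x,y\}$-bridge. Let $q\approx 1.225$ be the unique real root of $t^4-4t^3+4t^2-4t+4$ in the interval $(1,2)$. If $G\in\mathcal{K}_2$, then $(-1)^{|V(G)|}P(G,t)>0$ for all $t\in(1,q]$. -/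

import Mathlib

open scoped Polynomial

namespace GenTriangle

universe u

/-! ### The chromatic polynomial -/

/-- The chromatic polynomial of a finite simple graph, as Whitney's sum over the sets `S` of edges
of `(-1) ^ |S| * X ^ c(S)`, where `c(S)` is the number of connected components of the spanning
subgraph with edge set `S`. It counts proper colourings, by `chromaticPolynomial_eval_natCast`. -/
noncomputable def chromaticPolynomial {V : Type u} [Finite V] (G : SimpleGraph V) : ℤ[X] :=
  ∑ S ∈ G.edgeSet.toFinite.toFinset.powerset,
    (-1) ^ S.card *
      Polynomial.X ^ Nat.card (SimpleGraph.fromEdgeSet (S : Set (Sym2 V))).ConnectedComponent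

/-- Functions constant on the components of a graph are functions on the set of components. -/
theorem card_constant_on_components {V : Type u} [Finite V] (H : SimpleGraph V) (n : ℕ) :
    Nat.card {f : V → Fin n // ∀ a b, H.Adj a b → f a = f b} =
      n ^ Nat.card H.ConnectedComponent := by
  have hreach : ∀ f : V → Fin n, (∀ a b, H.Adj a b → f a = f b) →
      ∀ a b, H.Reachable a b → f a = f b := by
    rintro f hf a b ⟨p⟩
    induction p with
    | nil => rfl
    | cons h _ ih => exact (hf _ _ h).trans ih
  let e : {f : V → Fin n // ∀ a b, H.Adj a b → f a = f b} ≃ (H.ConnectedComponent → Fin n) :=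
    { toFun := fun f => Quot.lift f.1 (hreach f.1 f.2)
      invFun := fun g => ⟨fun v => g (H.connectedComponentMk v), fun a b h =>
        congrArg g (SimpleGraph.ConnectedComponent.eq.2 h.reachable)⟩
      left_inv := fun f => rfl
      right_inv := fun g => by
        funext c
        induction c using SimpleGraph.ConnectedComponent.ind
        rfl }
  rw [Nat.card_congr e, Nat.card_fun, Nat.card_fin]

open Classical in
/-- The value of the chromatic polynomial at a natural number `n` is the number of proper
`n`-colourings. -/
theorem chromaticPolynomial_eval_natCast {V : Type u} [Finite V] (G : SimpleGraph V) (n : ℕ) :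
    (chromaticPolynomial G).eval (n : ℤ) = (Nat.card (G.Coloring (Fin n)) : ℤ) := by
  have := Fintype.ofFinite V
  let E : Finset (Sym2 V) := G.edgeSet.toFinite.toFinset
  let mono : (V → Fin n) → Sym2 V → Prop := fun f e => ∀ a ∈ e, ∀ b ∈ e, f a = f b
  have hmono : ∀ (f : V → Fin n) (a b : V), mono f s(a, b) ↔ f a = f b := by
    intro f a b
    simp only [mono, Sym2.mem_iff]
    constructor
    · intro h
      exact h a (Or.inl rfl) b (Or.inr rfl)
    · rintro h x (rfl | rfl) y (rfl | rfl) <;> simp [h]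
  -- the number of colourings as a sum over all functions
  have h1 : (Nat.card (G.Coloring (Fin n)) : ℤ) =
      ∑ f : V → Fin n, ∏ e ∈ E, (1 + (if mono f e then (-1 : ℤ) else 0)) := by
    let eq : G.Coloring (Fin n) ≃ {f : V → Fin n // ∀ e ∈ E, ¬ mono f e} :=
      { toFun := fun c => ⟨c, by
          intro e he
          induction e using Sym2.ind with
          | _ a b =>
            rw [hmono]
            exact c.valid (by simpa [E] using he)⟩
        invFun := fun f => SimpleGraph.Coloring.mk f.1 (by
          intro a b hab
          have := f.2 s(a, b) (by simpa [E] using hab)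
          rwa [hmono] at this)
        left_inv := fun c => rfl
        right_inv := fun f => rfl }
    rw [Nat.card_congr eq, Nat.card_eq_fintype_card, Fintype.card_subtype, Finset.card_filter]
    push_cast
    refine Finset.sum_congr rfl fun f _ => ?_
    split_ifs with h
    · refine (Finset.prod_eq_one fun e he => ?_).symm
      simp [h e he]
    · push Not at h
      obtain ⟨e, he, hm⟩ := h
      exact (Finset.prod_eq_zero he (by simp [hm])).symm
  rw [h1]
  simp only [Finset.prod_one_add]
  rw [Finset.sum_comm]
  simp only [chromaticPolynomial, Polynomial.eval_finsetSum]
  refine Finset.sum_congr rfl fun S _ => ?_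
  have h2 : ∀ f : V → Fin n, (∏ e ∈ S, (if mono f e then (-1 : ℤ) else 0)) =
      if ∀ e ∈ S, mono f e then (-1) ^ S.card else 0 := by
    intro f
    rw [Finset.prod_ite_zero]
    simp
  simp only [h2]
  rw [← Finset.sum_filter, Finset.sum_const, ← Fintype.card_subtype, ← Nat.card_eq_fintype_card]
  have h3 : Nat.card {f : V → Fin n // ∀ e ∈ S, mono f e} =
      n ^ Nat.card (SimpleGraph.fromEdgeSet (S : Set (Sym2 V))).ConnectedComponent := by
    rw [← card_constant_on_components]
    refine Nat.card_congr (Equiv.subtypeEquivRight fun f => ?_)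
    constructor
    · intro h a b hab
      rw [SimpleGraph.fromEdgeSet_adj] at hab
      exact (hmono f a b).1 (h _ (by simpa using hab.1))
    · intro h e he
      induction e using Sym2.ind with
      | _ a b =>
        rw [hmono]
        by_cases hab : a = b
        · rw [hab]
        · exact h a b (by rw [SimpleGraph.fromEdgeSet_adj]; exact ⟨by simpa using he, hab⟩)
  rw [h3]
  simp [mul_comm]

/-! ### Generalised triangles -/

/-- Double subdivision of `G` at `u`, `v` (used for an edge `uv`): delete the edge `uv`, add two
new vertices `Sum.inr 0`, `Sum.inr 1`, and join both of them to `u` and `v`. -/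
def doubleSubdivision {V : Type u} (G : SimpleGraph V) (u v : V) : SimpleGraph (V ⊕ Fin 2) where
  Adj
    | Sum.inl a, Sum.inl b => G.Adj a b ∧ s(a, b) ≠ s(u, v)
    | Sum.inl a, Sum.inr _ => a = u ∨ a = v
    | Sum.inr _, Sum.inl a => a = u ∨ a = v
    | Sum.inr _, Sum.inr _ => False
  symm := ⟨by
    rintro (a | i) (b | j) h
    · exact ⟨h.1.symm, by rw [Sym2.eq_swap]; exact h.2⟩
    · exact h
    · exact h
    · exact h⟩
  loopless := ⟨by
    rintro (a | i) h
    · exact h.1.ne rfl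
    · exact h⟩

/-- Generalised triangles: the graphs isomorphic to `K₃` or to a graph obtained from `K₃` by a
sequence of double subdivisions of edges. -/
inductive IsGeneralisedTriangle : {V : Type u} → SimpleGraph V → Prop
  | triangle {V : Type u} (G : SimpleGraph V)
      (h : Nonempty (G ≃g (⊤ : SimpleGraph (Fin 3)))) : IsGeneralisedTriangle G
  | subdivide {V W : Type u} (H : SimpleGraph V) (G : SimpleGraph W) (u v : V)
      (hH : IsGeneralisedTriangle H) (huv : H.Adj u v)
      (h : Nonempty (G ≃g doubleSubdivision H u v)) : IsGeneralisedTriangle G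

/-! ### 2-cuts and their bridges -/

/-- A cut-set of a (finite) graph: a set of vertices whose removal increases the number of
components. -/
def IsCutSet {V : Type u} (G : SimpleGraph V) (S : Set V) : Prop :=
  Nat.card G.ConnectedComponent < Nat.card (G.induce Sᶜ).ConnectedComponent

/-- `{x, y}` is a 2-cut: a cut-set with exactly two elements. -/
def IsTwoCut {V : Type u} (G : SimpleGraph V) (x y : V) : Prop :=
  x ≠ y ∧ IsCutSet G {x, y}

/-- `B` is an `{x, y}`-bridge of `G`: the subgraph induced on `V(C) ∪ {x, y}` for a component `C`
of `G - {x, y}`. -/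
def IsPairBridge {V : Type u} (G : SimpleGraph V) (x y : V) (B : G.Subgraph) : Prop :=
  ∃ C : (G.induce ({x, y} : Set V)ᶜ).ConnectedComponent,
    B = (⊤ : G.Subgraph).induce (Subtype.val '' C.supp ∪ {x, y})

/-- The pair `{x, y}` has a trivial bridge, that is, a bridge with exactly three vertices. -/
def HasTrivialBridge {V : Type u} (G : SimpleGraph V) (x y : V) : Prop :=
  ∃ B : G.Subgraph, IsPairBridge G x y B ∧ B.verts.ncard = 3

/-- The class `K₂` of generalised triangles in which every 2-cut has a trivial bridge. -/
def ClassK2 {V : Type u} (G : SimpleGraph V) : Prop :=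
  IsGeneralisedTriangle G ∧ ∀ x y : V, IsTwoCut G x y → HasTrivialBridge G x y

/-! ### The constant `q` -/

theorem existsUnique_q :
    ∃! t : ℝ, t ∈ Set.Ioo (1 : ℝ) 2 ∧ t ^ 4 - 4 * t ^ 3 + 4 * t ^ 2 - 4 * t + 4 = 0 := by
  have hc : ContinuousOn (fun t : ℝ => t ^ 4 - 4 * t ^ 3 + 4 * t ^ 2 - 4 * t + 4)
      (Set.Icc 1 2) := by fun_prop
  have hmem : (0 : ℝ) ∈ Set.Ioo ((2 : ℝ) ^ 4 - 4 * 2 ^ 3 + 4 * 2 ^ 2 - 4 * 2 + 4)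
      (1 ^ 4 - 4 * 1 ^ 3 + 4 * 1 ^ 2 - 4 * 1 + 4) := by constructor <;> norm_num
  obtain ⟨t, ht, h0⟩ := intermediate_value_Ioo' (by norm_num : (1 : ℝ) ≤ 2) hc hmem
  refine ⟨t, ⟨ht, h0⟩, ?_⟩
  rintro s ⟨hs, hs0⟩
  have h0' : t ^ 4 - 4 * t ^ 3 + 4 * t ^ 2 - 4 * t + 4 = 0 := h0
  -- with `a = s - 1`, `b = t - 1` the polynomial is `(a ^ 2 - 1) ^ 2 - 4 * a`
  have key : (s - t) * (((s - 1) + (t - 1)) * (2 - (s - 1) ^ 2 - (t - 1) ^ 2) + 4) = 0 := by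
    linear_combination h0' - hs0
  rcases mul_eq_zero.1 key with h | h
  · linarith
  · exfalso
    have ha : 0 < s - 1 := by linarith [hs.1]
    have hb : 0 < t - 1 := by linarith [ht.1]
    have ha1 : (s - 1) ^ 2 < 1 := by nlinarith [hs.2]
    have hb1 : (t - 1) ^ 2 < 1 := by nlinarith [ht.2]
    have : 0 < ((s - 1) + (t - 1)) * (2 - (s - 1) ^ 2 - (t - 1) ^ 2) :=
      mul_pos (by linarith) (by linarith)
    linarith

/-- `q ≈ 1.225`, the unique real root of `t⁴ - 4t³ + 4t² - 4t + 4` in `(1, 2)`. -/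
noncomputable def q : ℝ := Classical.choose existsUnique_q.exists

theorem q_spec : q ∈ Set.Ioo (1 : ℝ) 2 ∧ q ^ 4 - 4 * q ^ 3 + 4 * q ^ 2 - 4 * q + 4 = 0 :=
  Classical.choose_spec existsUnique_q.exists

end GenTriangle

/-!
Give every edge of a graph two weights, one used when its ends share a colour and one when they
differ, and sum over all colourings the products of the edge weights; the weights `(0, 1)` count
proper colourings. Summing out a vertex of degree two replaces its two edges by a single weighted
edge, so the colour sum of a double subdivision of `H` is a colour sum of `H`. With polynomial
weights this goes down to the triangle, and the chromatic polynomial can be followed along at a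
real `t`.

There the induction preserves that each weight `(a, b)` satisfies `b > 0` and `0 ≤ a ≤ c b`, where
`c = (t - 1) / √(3 - t)`, and that every pair of separating vertices has a common neighbour of
degree two which is still joined to it by edges with `a = 0`. This is what a trivial bridge
provides, and by swapping twins it may be assumed to be one of the two vertices that are contracted.
The new weight then satisfies the bound again precisely because `2 √(3 - t) (t - 1) ≤ (2 - t)²`,
which holds up to `q`. On the triangle the bounds make the sum negative.
-/

open Polynomial

namespace GenTriangle

section ColorSum

variable {R S : Type*} [CommRing R] [CommRing S] {V W κ : Type*}

open Classical in
/-- The factor contributed to a colour sum by an edge whose ends have the colours in `s`. A weight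
is a pair, with first component for equal colours and second component for distinct colours, so
that the product of two weights is the weight of two parallel edges. -/
noncomputable def colorWeight (s : Sym2 κ) : R × R →+* R :=
  if s.IsDiag then RingHom.fst R R else RingHom.snd R R

theorem colorWeight_mk [DecidableEq κ] (i j : κ) (x : R × R) :
    colorWeight s(i, j) x = if i = j then x.1 else x.2 := by
  by_cases h : i = j <;> simp [colorWeight, h]

/-- The weight of the single edge that replaces a path of two edges of weights `x` and `y` when the
colour of the middle vertex is summed over `t` colours. -/
def seriesWeight (t : R) (x y : R × R) : R × R :=
  (x.1 * y.1 + (t - 1) * (x.2 * y.2), x.1 * y.2 + x.2 * y.1 + (t - 2) * (x.2 * y.2))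

/-- The colour sum with `t` colours of a single edge of weight `x`; here, as in `seriesWeight`, `t`
need not be a natural number. -/
def edgeSum (t : R) (x : R × R) : R :=
  t * (x.1 + (t - 1) * x.2)

theorem map_seriesWeight (φ : R →+* S) (t : R) (x y : R × R) :
    φ.prodMap φ (seriesWeight t x y) = seriesWeight (φ t) (φ.prodMap φ x) (φ.prodMap φ y) := by
  simp [seriesWeight, map_ofNat φ 2]

theorem map_edgeSum (φ : R →+* S) (t : R) (x : R × R) :
    φ (edgeSum t x) = edgeSum (φ t) (φ.prodMap φ x) := by
  simp [edgeSum]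

theorem sum_colorWeight_mul_colorWeight [Fintype κ] (i j : κ) (x y : R × R) :
    ∑ k, colorWeight s(i, k) x * colorWeight s(j, k) y =
      colorWeight s(i, j) (seriesWeight (Fintype.card κ : R) x y) := by
  classical
  have expand (l k : κ) (z : R × R) :
      colorWeight s(l, k) z = z.2 + if l = k then z.1 - z.2 else 0 := by
    rw [colorWeight_mk]; split_ifs <;> ring
  simp only [expand, add_mul, mul_add, Finset.sum_add_distrib, ite_mul, mul_ite, zero_mul,
    mul_zero, Finset.sum_ite_eq, Finset.sum_const, Finset.card_univ, Finset.mem_univ, if_true,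
    nsmul_eq_mul, seriesWeight]
  split_ifs <;> ring

theorem sum_sum_colorWeight [Fintype κ] (x : R × R) :
    ∑ i : κ, ∑ j, colorWeight s(i, j) x = edgeSum (Fintype.card κ : R) x := by
  have inner (i : κ) : ∑ j, colorWeight s(i, j) x = x.1 + (Fintype.card κ - 1) * x.2 := by
    simpa [colorWeight, seriesWeight] using sum_colorWeight_mul_colorWeight i i x 1
  simp only [inner, edgeSum, Finset.sum_const, Finset.card_univ, nsmul_eq_mul]

/-- The partition function of `G` with edge weights `w`: the sum over all maps from the vertices to
the colours `κ`, proper or not, of the products of the edge weights. As a `finsum`, it is only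
meaningful for finite `V` and `κ`. -/
noncomputable def colorSum (G : SimpleGraph V) (κ : Type*) (w : Sym2 V → R × R) : R :=
  ∑ᶠ f : V → κ, ∏ᶠ e ∈ G.edgeSet, colorWeight (e.map f) (w e)

theorem colorSum_comp_map {G : SimpleGraph V} {H : SimpleGraph W} (φ : G ≃g H)
    (w : Sym2 W → R × R) : colorSum G κ (w ∘ Sym2.map φ) = colorSum H κ w := by
  rw [colorSum, colorSum, ← finsum_comp_equiv (Equiv.arrowCongr φ.toEquiv.symm (.refl κ))]
  refine finsum_congr fun f => ?_
  rw [← finprod_set_coe_eq_finprod_mem, ← finprod_set_coe_eq_finprod_mem,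
    ← finprod_comp_equiv φ.mapEdgeSet]
  refine finprod_congr fun e => ?_
  congr 2
  rcases e with ⟨⟨_, _⟩, _⟩
  rfl

theorem colorSum_zero_one [Finite V] [Finite κ] (G : SimpleGraph V) :
    colorSum G κ (fun _ => ((0, 1) : R × R)) = Nat.card (G.Coloring κ) := by
  classical
  have := Fintype.ofFinite V
  have := Fintype.ofFinite κ
  have factor (f : V → κ) : ∏ᶠ e ∈ G.edgeSet, colorWeight (e.map f) ((0, 1) : R × R) =
      if ∀ x y, G.Adj x y → f x ≠ f y then 1 else 0 := by
    simp only [colorWeight, DFunLike.ite_apply]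
    rw [← SimpleGraph.coe_edgeFinset, finprod_mem_coe_finset]
    simp only [RingHom.coe_fst, RingHom.coe_snd, ← ite_not (Sym2.IsDiag _), Finset.prod_ite_zero]
    simp [Sym2.forall]
  let colorings : G.Coloring κ ≃ {f : V → κ // ∀ x y, G.Adj x y → f x ≠ f y} :=
    { toFun c := ⟨c, fun _ _ => c.valid⟩
      invFun f := .mk f fun h => f.2 _ _ h }
  rw [Nat.card_congr colorings, Nat.card_eq_fintype_card, Fintype.card_subtype, colorSum,
    finsum_eq_sum_of_fintype]
  simp only [factor, Finset.sum_boole]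

theorem colorSum_top_fin_three [Finite κ] (w : Sym2 (Fin 3) → R × R) :
    colorSum (⊤ : SimpleGraph (Fin 3)) κ w = edgeSum (Nat.card κ : R)
      (w s(0, 1) * seriesWeight (Nat.card κ : R) (w s(0, 2)) (w s(1, 2))) := by
  classical
  have := Fintype.ofFinite κ
  have edges : (⊤ : SimpleGraph (Fin 3)).edgeFinset = {s(0, 1), s(0, 2), s(1, 2)} := by decide
  let e : κ × κ × κ ≃ (Fin 3 → κ) :=
    { toFun p := ![p.1, p.2.1, p.2.2]
      invFun f := (f 0, f 1, f 2)
      right_inv f := by ext i; fin_cases i <;> rfl }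
  rw [colorSum, ← finsum_comp_equiv e, finsum_eq_sum_of_fintype, Nat.card_eq_fintype_card,
    ← sum_sum_colorWeight]
  simp only [map_mul, ← sum_colorWeight_mul_colorWeight, Finset.mul_sum, Fintype.sum_prod_type]
  refine Finset.sum_congr rfl fun i _ => Finset.sum_congr rfl fun j _ =>
    Finset.sum_congr rfl fun k _ => ?_
  have vals : e (i, j, k) = ![i, j, k] := rfl
  rw [← SimpleGraph.coe_edgeFinset, finprod_mem_coe_finset, edges]
  simp [vals]

theorem edgeSet_doubleSubdivision (H : SimpleGraph V) (u v : V) :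
    (doubleSubdivision H u v).edgeSet = Sym2.map Sum.inl '' (H.edgeSet \ {s(u, v)}) ∪
      ⋃ i, {s(.inl u, .inr i), s(.inl v, .inr i)} := by
  have old (x y : V) : s(Sum.inl x, Sum.inl y) ∈
      Sym2.map (Sum.inl : V → V ⊕ Fin 2) '' (H.edgeSet \ {s(u, v)}) ↔
        s(x, y) ∈ H.edgeSet \ {s(u, v)} :=
    (Sym2.map.injective Sum.inl_injective).mem_set_image (a := s(x, y))
  ext e
  induction e using Sym2.ind with
  | _ x y =>
    rcases x with x | i <;> rcases y with y | j
    · simp [doubleSubdivision, old]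
    · fin_cases j <;> simp [doubleSubdivision, Sym2.exists]
    · fin_cases i <;> simp [doubleSubdivision, Sym2.exists]
    · simp [doubleSubdivision, Sym2.exists]

open Classical in
/-- The weighting of a graph induced by a weighting `w` of its double subdivision at `u`, `v`: the
edge `uv` receives the two new paths, each contracted to an edge, in parallel. -/
noncomputable def contractWeights (t : R) (u v : V) (w : Sym2 (V ⊕ Fin 2) → R × R) (e : Sym2 V) :
    R × R :=
  if e = s(u, v) then ∏ i, seriesWeight t (w s(.inl u, .inr i)) (w s(.inl v, .inr i))
  else w (e.map .inl)

theorem contractWeights_self (t : R) (u v : V) (w : Sym2 (V ⊕ Fin 2) → R × R) :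
    contractWeights t u v w s(u, v) =
      ∏ i, seriesWeight t (w s(.inl u, .inr i)) (w s(.inl v, .inr i)) :=
  if_pos rfl

theorem contractWeights_of_ne (t : R) {u v : V} (w : Sym2 (V ⊕ Fin 2) → R × R) {e : Sym2 V}
    (he : e ≠ s(u, v)) : contractWeights t u v w e = w (e.map .inl) :=
  if_neg he

theorem map_contractWeights (φ : R →+* S) (t : R) (u v : V) (w : Sym2 (V ⊕ Fin 2) → R × R) :
    φ.prodMap φ ∘ contractWeights t u v w = contractWeights (φ t) u v (φ.prodMap φ ∘ w) := by
  funext e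
  simp only [contractWeights, Function.comp_apply, apply_ite (φ.prodMap φ), map_prod,
    map_seriesWeight]

theorem finprod_edgeSet_doubleSubdivision [Finite V] {M : Type*} [CommMonoid M]
    {H : SimpleGraph V} {u v : V} (huv : u ≠ v) (F : Sym2 (V ⊕ Fin 2) → M) :
    ∏ᶠ e ∈ (doubleSubdivision H u v).edgeSet, F e =
      (∏ᶠ e ∈ H.edgeSet \ {s(u, v)}, F (e.map .inl)) *
        ∏ i, F s(.inl u, .inr i) * F s(.inl v, .inr i) := by
  have disjoint : Disjoint (Sym2.map Sum.inl '' (H.edgeSet \ {s(u, v)}))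
      (⋃ i : Fin 2, {s(.inl u, .inr i), s(.inl v, .inr i)}) := by
    rw [Set.disjoint_left]
    rintro _ ⟨⟨x, y⟩, -, rfl⟩
    simp
  rw [edgeSet_doubleSubdivision, finprod_mem_union disjoint
      ((Set.toFinite _).image _) (Set.finite_iUnion fun _ => by simp),
    finprod_mem_image (Sym2.map.injective Sum.inl_injective).injOn,
    finprod_mem_iUnion ?_ (fun _ => by simp),
    finprod_eq_prod_of_fintype (α := Fin 2)]
  · congr 1
    exact Finset.prod_congr rfl fun i _ => finprod_mem_pair (by simpa using huv)
  · intro i j hij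
    simp [Set.disjoint_left, hij]

theorem colorSum_doubleSubdivision [Finite V] [Finite κ] {H : SimpleGraph V} {u v : V}
    (huv : H.Adj u v) (w : Sym2 (V ⊕ Fin 2) → R × R) :
    colorSum (doubleSubdivision H u v) κ w =
      colorSum H κ (contractWeights (Nat.card κ : R) u v w) := by
  classical
  have := Fintype.ofFinite V
  have := Fintype.ofFinite κ
  rw [colorSum, colorSum, ← finsum_comp_equiv (Equiv.sumArrowEquivProdArrow V (Fin 2) κ).symm,
    finsum_eq_sum_of_fintype, Fintype.sum_prod_type, finsum_eq_sum_of_fintype]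
  refine Finset.sum_congr rfl fun f _ => ?_
  have contracted (i : Fin 2) : ∑ k, colorWeight s(f u, k) (w s(.inl u, .inr i)) *
      colorWeight s(f v, k) (w s(.inl v, .inr i)) = colorWeight s(f u, f v)
        (seriesWeight (Nat.card κ : R) (w s(.inl u, .inr i)) (w s(.inl v, .inr i))) := by
    rw [sum_colorWeight_mul_colorWeight, Nat.card_eq_fintype_card]
  set w' := contractWeights (Nat.card κ : R) u v w with hw'
  calc ∑ g : Fin 2 → κ, ∏ᶠ e ∈ (doubleSubdivision H u v).edgeSet,
        colorWeight (e.map (Sum.elim f g)) (w e)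
      = ∑ g : Fin 2 → κ, (∏ᶠ e ∈ H.edgeSet \ {s(u, v)}, colorWeight (e.map f) (w (e.map .inl))) *
          ∏ i, colorWeight s(f u, g i) (w s(.inl u, .inr i)) *
            colorWeight s(f v, g i) (w s(.inl v, .inr i)) := by
        simp only [finprod_edgeSet_doubleSubdivision huv.ne, Sym2.map_map, Sum.elim_comp_inl,
          Sym2.map_mk, Sum.elim_inl, Sum.elim_inr]
    _ = (∏ᶠ e ∈ H.edgeSet \ {s(u, v)}, colorWeight (e.map f) (w' e)) *
          colorWeight s(f u, f v) (w' s(u, v)) := by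
        rw [← Finset.mul_sum, ← Fintype.prod_sum fun i k =>
          colorWeight s(f u, k) (w s(.inl u, .inr i)) * colorWeight s(f v, k) (w s(.inl v, .inr i))]
        simp only [contracted, ← map_prod]
        rw [hw', contractWeights_self]
        congr 1
        exact finprod_mem_congr rfl fun e he => by rw [contractWeights_of_ne _ _ he.2]
    _ = ∏ᶠ e ∈ H.edgeSet, colorWeight (e.map f) (w' e) := by
        rw [mul_comm, ← finprod_mem_mul_sdiff
            (Set.singleton_subset_iff.2 (H.mem_edgeSet.2 huv)) (Set.toFinite _),
          finprod_mem_singleton, Sym2.map_mk]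

end ColorSum

section Connectivity

variable {V W : Type*} {G : SimpleGraph V} {H : SimpleGraph W}

theorem preconnected_of_adj_reachable (f : V → W)
    (hadj : ∀ x y, G.Adj x y → H.Reachable (f x) (f y)) (hsurj : ∀ w, ∃ x, H.Reachable (f x) w)
    (hG : G.Preconnected) : H.Preconnected := by
  have hreach {x y : V} (h : G.Reachable x y) : H.Reachable (f x) (f y) := by
    obtain ⟨p⟩ := h
    induction p with
    | nil => rfl
    | cons h _ ih => exact (hadj _ _ h).trans ih
  intro a b
  obtain ⟨x, hx⟩ := hsurj a
  obtain ⟨y, hy⟩ := hsurj b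
  exact hx.symm.trans ((hreach (hG x y)).trans hy)

theorem preconnected_induce_compl_image_iff (φ : G ≃g H) (S : Set V) :
    (H.induce (φ '' S)ᶜ).Preconnected ↔ (G.induce Sᶜ).Preconnected :=
  (φ.induce (Set.image_compl_eq φ.bijective ▸ φ.injective.injOn.bijOn_image)).preconnected_iff.symm

theorem isCutSet_of_not_preconnected [Finite V] {S : Set V} (hG : G.Preconnected)
    (hS : ¬(G.induce Sᶜ).Preconnected) : IsCutSet G S := by
  have hle : Nat.card G.ConnectedComponent ≤ 1 :=
    Finite.card_le_one_iff_subsingleton.2 hG.subsingleton_connectedComponent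
  refine hle.trans_lt (not_le.1 fun h => hS fun x y => ?_)
  have := Finite.card_le_one_iff_subsingleton.1 h
  exact SimpleGraph.ConnectedComponent.eq.1 (Subsingleton.elim _ _)

theorem HasTrivialBridge.exists_neighborSet_subset {x y : V} (hxy : x ≠ y)
    (h : HasTrivialBridge G x y) : ∃ z ∉ ({x, y} : Set V), G.neighborSet z ⊆ {x, y} := by
  obtain ⟨_, ⟨C, rfl⟩, hcard⟩ := h
  have hdisj : Disjoint (Subtype.val '' C.supp) {x, y} := by
    rw [Set.disjoint_left]
    rintro _ ⟨a, -, rfl⟩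
    exact a.2
  have hfin : (Subtype.val '' C.supp ∪ {x, y}).Finite :=
    Set.finite_of_ncard_ne_zero (hcard.trans_ne three_ne_zero)
  rw [SimpleGraph.Subgraph.induce_verts,
    Set.ncard_union_eq hdisj (hfin.subset Set.subset_union_left), Set.ncard_pair hxy,
    show 3 = 1 + 2 from rfl, Nat.add_right_cancel_iff, Set.ncard_eq_one] at hcard
  obtain ⟨z, hz⟩ := hcard
  obtain ⟨⟨z, hzxy⟩, hzC, rfl⟩ : z ∈ Subtype.val '' C.supp := hz ▸ rfl
  refine ⟨z, hzxy, fun w hw => by_contra fun hwxy => hw.ne' ?_⟩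
  have hadj : (G.induce {x, y}ᶜ).Adj ⟨z, hzxy⟩ ⟨w, hwxy⟩ := hw
  have hwC : w ∈ Subtype.val '' C.supp := ⟨⟨w, hwxy⟩, (C.mem_supp_congr_adj hadj).1 hzC, rfl⟩
  rwa [hz] at hwC

end Connectivity

section DoubleSubdivision

variable {V : Type*} {H : SimpleGraph V} {u v : V}

theorem neighborSet_doubleSubdivision_inr (i : Fin 2) :
    (doubleSubdivision H u v).neighborSet (.inr i) = {.inl u, .inl v} := by
  ext (x | j) <;> simp [doubleSubdivision]

theorem preconnected_induce_compl_doubleSubdivision {S : Set (V ⊕ Fin 2)}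
    (hS : (H.induce (Sum.inl ⁻¹' S)ᶜ).Preconnected) (huv : .inl u ∉ S ∨ .inl v ∉ S) {j : Fin 2}
    (hj : .inr j ∉ S) : ((doubleSubdivision H u v).induce Sᶜ).Preconnected := by
  refine preconnected_of_adj_reachable (fun x => ⟨.inl x.1, x.2⟩) ?_ ?_ hS
  · rintro ⟨x, hx⟩ ⟨y, hy⟩ hxy
    by_cases he : s(x, y) = s(u, v)
    · have hxj : ((doubleSubdivision H u v).induce Sᶜ).Adj ⟨.inl x, hx⟩ ⟨.inr j, hj⟩ :=
        Sym2.mem_iff.1 (he ▸ Sym2.mem_mk_left x y)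
      have hjy : ((doubleSubdivision H u v).induce Sᶜ).Adj ⟨.inr j, hj⟩ ⟨.inl y, hy⟩ :=
        Sym2.mem_iff.1 (he ▸ Sym2.mem_mk_right x y)
      exact hxj.reachable.trans hjy.reachable
    · have hadj : ((doubleSubdivision H u v).induce Sᶜ).Adj ⟨.inl x, hx⟩ ⟨.inl y, hy⟩ := ⟨hxy, he⟩
      exact hadj.reachable
  · obtain ⟨r, hr, hru⟩ : ∃ r, .inl r ∉ S ∧ (r = u ∨ r = v) := by
      rcases huv with h | h
      exacts [⟨u, h, .inl rfl⟩, ⟨v, h, .inr rfl⟩]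
    rintro ⟨x | i, hx⟩
    · exact ⟨⟨x, hx⟩, .rfl⟩
    · have hadj : ((doubleSubdivision H u v).induce Sᶜ).Adj ⟨.inl r, hr⟩ ⟨.inr i, hx⟩ := hru
      exact ⟨⟨r, hr⟩, hadj.reachable⟩

theorem not_preconnected_induce_compl_doubleSubdivision :
    ¬((doubleSubdivision H u v).induce {.inl u, .inl v}ᶜ).Preconnected := by
  intro h
  have : Nontrivial ({.inl u, .inl v}ᶜ : Set (V ⊕ Fin 2)) :=
    ⟨⟨.inr 0, by simp⟩, ⟨.inr 1, by simp⟩, by simp⟩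
  obtain ⟨y, hy⟩ := h.exists_adj_of_nontrivial ⟨.inr 0, by simp⟩
  exact y.2 ((neighborSet_doubleSubdivision_inr 0).le hy)

theorem preconnected_induce_compl_of_doubleSubdivision {S : Set V} (huv : H.Adj u v)
    (h : ((doubleSubdivision H u v).induce (Sum.inl '' S)ᶜ).Preconnected) :
    (H.induce Sᶜ).Preconnected := by
  intro a
  have hends (w w' : ↥Sᶜ) (hw : ↑w = u ∨ ↑w = v) (hw' : ↑w' = u ∨ ↑w' = v) :
      (H.induce Sᶜ).Reachable w w' := by
    obtain ⟨w, hwS⟩ := w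
    obtain ⟨w', hwS'⟩ := w'
    have hadj (huS : u ∈ Sᶜ) (hvS : v ∈ Sᶜ) : (H.induce Sᶜ).Adj ⟨u, huS⟩ ⟨v, hvS⟩ := huv
    rcases hw with rfl | rfl <;> rcases hw' with rfl | rfl
    exacts [.rfl, (hadj _ _).reachable, (hadj _ _).reachable.symm, .rfl]
  obtain ⟨r, hr⟩ : ∃ r : ↥Sᶜ, ∀ w : ↥Sᶜ, ↑w = u ∨ ↑w = v → (H.induce Sᶜ).Reachable w r := by
    by_cases hex : ∃ r : ↥Sᶜ, ↑r = u ∨ ↑r = v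
    · exact hex.imp fun r hr w hw => hends w r hw hr
    · exact ⟨a, fun w hw => (hex ⟨w, hw⟩).elim⟩
  have hmem {w : V} (hw : .inl w ∈ (Sum.inl '' S : Set (V ⊕ Fin 2))ᶜ) : w ∈ Sᶜ :=
    fun h => hw ⟨w, h, rfl⟩
  let retract : ↥(Sum.inl '' S : Set (V ⊕ Fin 2))ᶜ → ↥Sᶜ
    | ⟨.inl w, hw⟩ => ⟨w, hmem hw⟩
    | ⟨.inr _, _⟩ => r
  have hsurj (w : ↥Sᶜ) : ∃ x, (H.induce Sᶜ).Reachable (retract x) w :=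
    ⟨⟨.inl w, Sum.inl_injective.mem_set_image.not.2 w.2⟩, .rfl⟩
  refine preconnected_of_adj_reachable retract ?_ hsurj h a
  rintro ⟨x | i, hx⟩ ⟨y | j, hy⟩ hxy
  · have hadj : (H.induce Sᶜ).Adj ⟨x, hmem hx⟩ ⟨y, hmem hy⟩ := hxy.1
    exact hadj.reachable
  · exact hr ⟨x, hmem hx⟩ hxy
  · exact (hr ⟨y, hmem hy⟩ hxy).symm
  · rfl

end DoubleSubdivision

theorem IsGeneralisedTriangle.finite {V : Type*} {G : SimpleGraph V}
    (hG : IsGeneralisedTriangle G) : Finite V := by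
  induction hG with
  | triangle G h => exact .of_equiv _ h.some.symm.toEquiv
  | subdivide _ _ _ _ _ _ h _ => exact .of_equiv _ h.some.symm.toEquiv

theorem IsGeneralisedTriangle.preconnected_induce_compl {V : Type*} {G : SimpleGraph V}
    (hG : IsGeneralisedTriangle G) {S : Set V} (hS : G.IsClique S) :
    (G.induce Sᶜ).Preconnected := by
  induction hG with
  | triangle G h =>
    obtain ⟨φ⟩ := h
    intro x y
    rcases eq_or_ne x y with rfl | hxy
    · rfl
    · have hadj : (G.induce Sᶜ).Adj x y :=
        φ.map_adj_iff.1 (φ.injective.ne (Subtype.val_injective.ne hxy))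
      exact hadj.reachable
  | subdivide H G u v _ huv h ih =>
    obtain ⟨φ⟩ := h
    rw [← preconnected_induce_compl_image_iff φ]
    have hclique : (doubleSubdivision H u v).IsClique (φ '' S) := by
      rintro _ ⟨x, hx, rfl⟩ _ ⟨y, hy, rfl⟩ hxy
      exact φ.map_adj_iff.2 (hS hx hy (ne_of_apply_ne φ hxy))
    generalize φ '' S = T at hclique
    have huvT : .inl u ∉ T ∨ .inl v ∉ T := by
      by_contra! h
      exact (hclique h.1 h.2 (Sum.inl_injective.ne huv.ne)).2 rfl
    obtain ⟨j, hj⟩ : ∃ j, .inr j ∉ T := by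
      by_contra! h
      exact hclique (h 0) (h 1) (by simp)
    refine preconnected_induce_compl_doubleSubdivision (ih ?_) huvT hj
    exact fun x hx y hy hxy => (hclique hx hy (Sum.inl_injective.ne hxy)).1

theorem IsGeneralisedTriangle.preconnected {V : Type*} {G : SimpleGraph V}
    (hG : IsGeneralisedTriangle G) : G.Preconnected := by
  have h := hG.preconnected_induce_compl SimpleGraph.isClique_empty
  rwa [Set.compl_empty, G.induceUnivIso.preconnected_iff] at h

theorem IsGeneralisedTriangle.adj_of_neighborSet_subset {V : Type*} {G : SimpleGraph V}
    (hG : IsGeneralisedTriangle G) {x y z : V} (hxy : x ≠ y) (hz : z ∉ ({x, y} : Set V))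
    (hsub : G.neighborSet z ⊆ {x, y}) : G.Adj z x := by
  have hzx : z ≠ x := fun h => hz (.inl h)
  have hzy : z ≠ y := fun h => hz (.inr h)
  have : Nontrivial ({y}ᶜ : Set V) := ⟨⟨z, hzy⟩, ⟨x, hxy⟩, by simpa [Subtype.ext_iff] using hzx⟩
  have hconn := hG.preconnected_induce_compl (S := {y}) (SimpleGraph.isClique_singleton y)
  obtain ⟨w, hw⟩ := hconn.exists_adj_of_nontrivial ⟨z, hzy⟩
  rcases hsub hw with h | h
  · exact h ▸ hw
  · exact (w.2 h).elim

theorem ClassK2.exists_neighborSet_eq_pair {V : Type*} {G : SimpleGraph V}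
    (hG : ClassK2 G) {x y : V} (h : ¬(G.induce {x, y}ᶜ).Preconnected) :
    ∃ z, G.neighborSet z = {x, y} := by
  obtain ⟨htri, hbridge⟩ := hG
  have := htri.finite
  have hxy : x ≠ y := by
    rintro rfl
    exact h (htri.preconnected_induce_compl (by simp))
  obtain ⟨z, hz, hsub⟩ := (hbridge x y
    ⟨hxy, isCutSet_of_not_preconnected htri.preconnected h⟩).exists_neighborSet_subset hxy
  have hzx := htri.adj_of_neighborSet_subset hxy hz hsub
  rw [Set.pair_comm] at hz hsub
  have hzy := htri.adj_of_neighborSet_subset hxy.symm hz hsub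
  exact ⟨z, (Set.pair_comm x y ▸ hsub).antisymm (Set.pair_subset hzx hzy)⟩

/-- The weights along which the sign of the chromatic polynomial is propagated: the ratio of the
weight for equal colours to the (positive) weight for distinct colours lies in `[0, c]`. -/
structure Admissible (c : ℝ) (x : ℝ × ℝ) : Prop where
  snd_pos : 0 < x.2
  fst_nonneg : 0 ≤ x.1
  fst_le : x.1 ≤ c * x.2

/-- The inequalities between `t` and the bound `c` on the ratios of admissible weights under which
contracting a double subdivision preserves admissibility (`series`) and an admissibly weighted
triangle has negative colour sum (`triangle`). -/
structure IsRatioBound (t c : ℝ) : Prop where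
  one_lt : 1 < t
  pos : 0 < c
  series : (t - 1) * (c ^ 2 + (t - 1)) ≤ c * (2 - t) * (2 - t - 2 * c)
  triangle : c * (c ^ 2 + (t - 1)) < (t - 1) * (2 - t - 2 * c)

section RatioBound

variable {t c : ℝ} {x y z x' y' : ℝ × ℝ}

theorem IsRatioBound.two_mul_lt (hc : IsRatioBound t c) : 2 * c < 2 - t := by
  have ht : 0 < t - 1 := sub_pos.2 hc.one_lt
  have hpos : 0 < c * (c ^ 2 + (t - 1)) := mul_pos hc.pos (by positivity)
  linarith [pos_of_mul_pos_right (hpos.trans hc.triangle) ht.le]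

theorem Admissible.seriesWeight_fst_nonneg (ht : 1 ≤ t) (hx : Admissible c x)
    (hy : Admissible c y) : 0 ≤ (seriesWeight t x y).1 :=
  add_nonneg (mul_nonneg hx.fst_nonneg hy.fst_nonneg)
    (mul_nonneg (sub_nonneg.2 ht) (mul_nonneg hx.snd_pos.le hy.snd_pos.le))

theorem Admissible.seriesWeight_fst_le (hx : Admissible c x) (hy : Admissible c y) :
    (seriesWeight t x y).1 ≤ (c ^ 2 + (t - 1)) * (x.2 * y.2) := by
  have h : x.1 * y.1 ≤ (c * x.2) * (c * y.2) :=
    mul_le_mul hx.fst_le hy.fst_le hy.fst_nonneg (hx.fst_nonneg.trans hx.fst_le)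
  simp only [seriesWeight]
  linarith

theorem Admissible.seriesWeight_snd_le (hx : Admissible c x) (hy : Admissible c y) :
    (seriesWeight t x y).2 ≤ -((2 - t - 2 * c) * (x.2 * y.2)) := by
  have hxy : x.1 * y.2 ≤ c * x.2 * y.2 := mul_le_mul_of_nonneg_right hx.fst_le hy.snd_pos.le
  have hyx : x.2 * y.1 ≤ x.2 * (c * y.2) := mul_le_mul_of_nonneg_left hy.fst_le hx.snd_pos.le
  simp only [seriesWeight]
  linarith

theorem IsRatioBound.admissible_mul_seriesWeight (hc : IsRatioBound t c) (hx : Admissible c x)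
    (hy : Admissible c y) (hx' : Admissible c x') (hy' : Admissible c y') (hx0 : x'.1 = 0)
    (hy0 : y'.1 = 0) : Admissible c (seriesWeight t x' y' * seriesWeight t x y) := by
  have ht : 0 < t - 1 := sub_pos.2 hc.one_lt
  have ht2 : 0 < 2 - t := by linarith [hc.two_mul_lt, hc.pos]
  have hgap : 0 < 2 - t - 2 * c := sub_pos.2 hc.two_mul_lt
  have hb : 0 < x.2 * y.2 := mul_pos hx.snd_pos hy.snd_pos
  have hb' : 0 < x'.2 * y'.2 := mul_pos hx'.snd_pos hy'.snd_pos
  have hfst := hx.seriesWeight_fst_nonneg hc.one_lt.le hy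
  have hfst_le := hx.seriesWeight_fst_le (t := t) hy
  have hsnd := hx.seriesWeight_snd_le (t := t) hy
  have hsnd_pos : 0 < -(seriesWeight t x y).2 := by linarith [mul_pos hgap hb]
  generalize seriesWeight t x y = s at *
  have hprod : seriesWeight t x' y' * s =
      ((t - 1) * (x'.2 * y'.2) * s.1, (2 - t) * (x'.2 * y'.2) * -s.2) := by
    ext <;> simp only [seriesWeight, hx0, hy0, Prod.fst_mul, Prod.snd_mul] <;> ring
  rw [hprod]
  refine ⟨by positivity, by positivity, ?_⟩
  calc (t - 1) * (x'.2 * y'.2) * s.1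
      ≤ (t - 1) * (x'.2 * y'.2) * ((c ^ 2 + (t - 1)) * (x.2 * y.2)) := by gcongr
    _ = (x'.2 * y'.2) * (x.2 * y.2) * ((t - 1) * (c ^ 2 + (t - 1))) := by ring
    _ ≤ (x'.2 * y'.2) * (x.2 * y.2) * (c * (2 - t) * (2 - t - 2 * c)) :=
        mul_le_mul_of_nonneg_left hc.series (mul_pos hb' hb).le
    _ = c * ((2 - t) * (x'.2 * y'.2)) * ((2 - t - 2 * c) * (x.2 * y.2)) := by ring
    _ ≤ c * ((2 - t) * (x'.2 * y'.2)) * -s.2 :=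
        mul_le_mul_of_nonneg_left (by linarith) (mul_pos hc.pos (mul_pos ht2 hb')).le
    _ = c * ((2 - t) * (x'.2 * y'.2) * -s.2) := by ring

theorem IsRatioBound.edgeSum_mul_seriesWeight_neg (hc : IsRatioBound t c) (hx : Admissible c x)
    (hy : Admissible c y) (hz : Admissible c z) : edgeSum t (x * seriesWeight t y z) < 0 := by
  have ht : 0 < t - 1 := sub_pos.2 hc.one_lt
  have hxb := hx.snd_pos
  have hb : 0 < x.2 * (y.2 * z.2) := mul_pos hxb (mul_pos hy.snd_pos hz.snd_pos)
  refine mul_neg_of_pos_of_neg (one_pos.trans hc.one_lt) ?_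
  calc x.1 * (seriesWeight t y z).1 + (t - 1) * (x.2 * (seriesWeight t y z).2)
      ≤ c * x.2 * ((c ^ 2 + (t - 1)) * (y.2 * z.2)) +
          (t - 1) * (x.2 * -((2 - t - 2 * c) * (y.2 * z.2))) := by
        gcongr
        · exact hy.seriesWeight_fst_nonneg hc.one_lt.le hz
        · exact mul_nonneg hc.pos.le hxb.le
        · exact hx.fst_le
        · exact hy.seriesWeight_fst_le hz
        · exact hy.seriesWeight_snd_le hz
    _ = x.2 * (y.2 * z.2) * (c * (c ^ 2 + (t - 1)) - (t - 1) * (2 - t - 2 * c)) := by ring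
    _ < 0 := mul_neg_of_pos_of_neg hb (sub_neg.2 hc.triangle)

end RatioBound

section Quartic

variable {t : ℝ}

theorem strictAntiOn_quartic :
    StrictAntiOn (fun t : ℝ => t ^ 4 - 4 * t ^ 3 + 4 * t ^ 2 - 4 * t + 4) (Set.Ioo 1 2) := by
  intro s hs t ht hst
  have hs1 : (s - 1) ^ 2 < 1 := by nlinarith [hs.1, hs.2]
  have ht1 : (t - 1) ^ 2 < 1 := by nlinarith [ht.1, ht.2]
  have hpos : 0 < ((s - 1) + (t - 1)) * (2 - (s - 1) ^ 2 - (t - 1) ^ 2) :=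
    mul_pos (by linarith [hs.1, ht.1]) (by linarith)
  -- with `a = s - 1`, `b = t - 1` the quartic takes the values `(a ^ 2 - 1) ^ 2 - 4 * a`
  -- and `(b ^ 2 - 1) ^ 2 - 4 * b`, whose difference has the factor `b - a`
  have hmul := mul_pos (sub_pos.2 hst) (add_pos four_pos hpos)
  dsimp only
  linarith

theorem q_lt : q < 123 / 100 := by
  by_contra! h
  have hle := strictAntiOn_quartic.antitoneOn ⟨by norm_num, by norm_num⟩ q_spec.1 h
  norm_num [q_spec.2] at hle

theorem four_mul_three_sub_mul_sq_le (ht : t ∈ Set.Ioc (1 : ℝ) q) :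
    4 * (3 - t) * (t - 1) ^ 2 ≤ (2 - t) ^ 4 := by
  have hle := strictAntiOn_quartic.antitoneOn ⟨ht.1, ht.2.trans_lt q_spec.1.2⟩ q_spec.1 ht.2
  -- the difference of the two sides is the quartic defining `q`
  linarith [q_spec.2]

-- The condition `series` reads `(3 - t) * c + (t - 1) ^ 2 / c ≤ (2 - t) ^ 2`, and this `c`
-- minimises its left-hand side.
theorem isRatioBound_of_mem_Ioc (ht : t ∈ Set.Ioc (1 : ℝ) q) :
    IsRatioBound t ((t - 1) / √(3 - t)) := by
  have htq : t < 123 / 100 := ht.2.trans_lt q_lt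
  have hs : 0 < t - 1 := sub_pos.2 ht.1
  have hsqrt : 1 < √(3 - t) := Real.lt_sqrt_of_sq_lt (by linarith)
  have hsq : (3 - t) * ((t - 1) / √(3 - t)) ^ 2 = (t - 1) ^ 2 := by
    rw [div_pow, Real.sq_sqrt (by linarith)]
    field_simp [show 3 - t ≠ 0 by linarith]
  have hpos : 0 < (t - 1) / √(3 - t) := div_pos hs (by linarith)
  have hlt : (t - 1) / √(3 - t) < t - 1 := div_lt_self hs hsqrt
  generalize (t - 1) / √(3 - t) = c at *
  have hroot : 2 * (3 - t) * c ≤ (2 - t) ^ 2 := by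
    refine abs_le_of_sq_le_sq' ?_ (sq_nonneg _) |>.2
    linarith [four_mul_three_sub_mul_sq_le ht, congrArg (4 * (3 - t) * ·) hsq]
  refine ⟨ht.1, hpos, ?_, ?_⟩
  · have : 0 ≤ c * ((2 - t) ^ 2 - 2 * (3 - t) * c) := mul_nonneg hpos.le (sub_nonneg.2 hroot)
    linarith
  · calc c * (c ^ 2 + (t - 1)) < (t - 1) * ((t - 1) ^ 2 + (t - 1)) := by gcongr
      _ < (t - 1) * (2 - t - 2 * (t - 1)) := by
        gcongr
        nlinarith
      _ < (t - 1) * (2 - t - 2 * c) := by gcongr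

end Quartic

section Weighting

variable {V W : Type*} {G : SimpleGraph V} {H : SimpleGraph W} {c : ℝ} {w : Sym2 V → ℝ × ℝ}

/-- The invariant of the induction on generalised triangles: all edge weights are admissible, and
every pair of separating vertices is joined by a path of length two through a vertex of degree two
whose edges still forbid equal colours. The latter is the weighted form of a trivial bridge; the
case `x = y` does no harm, since a generalised triangle has no cut vertex. -/
structure IsAdmissibleWeighting (G : SimpleGraph V) (c : ℝ) (w : Sym2 V → ℝ × ℝ) : Prop where
  admissible : ∀ e ∈ G.edgeSet, Admissible c (w e)
  exists_bridge : ∀ x y, ¬(G.induce {x, y}ᶜ).Preconnected →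
    ∃ z, G.neighborSet z = {x, y} ∧ (w s(x, z)).1 = 0 ∧ (w s(y, z)).1 = 0

theorem ClassK2.isAdmissibleWeighting_zero_one (hG : ClassK2 G) (hc : 0 ≤ c) :
    IsAdmissibleWeighting G c fun _ => (0, 1) where
  admissible _ _ := ⟨one_pos, le_rfl, by simpa⟩
  exists_bridge _ _ h := (hG.exists_neighborSet_eq_pair h).imp fun _ hz => ⟨hz, rfl, rfl⟩

theorem IsAdmissibleWeighting.comp_map (φ : H ≃g G) (hw : IsAdmissibleWeighting G c w) :
    IsAdmissibleWeighting H c (w ∘ Sym2.map φ) where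
  admissible e he := hw.admissible _ (φ.toHom.map_mem_edgeSet he)
  exists_bridge x y h := by
    rw [← preconnected_induce_compl_image_iff φ, Set.image_pair] at h
    obtain ⟨z, hz, hx, hy⟩ := hw.exists_bridge _ _ h
    refine ⟨φ.symm z, ?_, by simpa using hx, by simpa using hy⟩
    ext a
    rw [SimpleGraph.mem_neighborSet, ← φ.map_adj_iff, φ.apply_symm_apply,
      ← SimpleGraph.mem_neighborSet, hz]
    simp

theorem exists_iso_apply_eq_of_neighborSet_eq {a b : V} (h : G.neighborSet a = G.neighborSet b) :
    ∃ φ : G ≃g G, φ a = b ∧ ∀ x, x ≠ a → x ≠ b → φ x = x := by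
  classical
  have hswap (x y : V) : G.Adj (Equiv.swap a b x) y ↔ G.Adj x y := by
    rw [Equiv.swap_apply_def]
    split_ifs with hxa hxb
    · rw [hxa]
      exact (Set.ext_iff.1 h y).symm
    · rw [hxb]
      exact Set.ext_iff.1 h y
    · rfl
  refine ⟨⟨Equiv.swap a b, ?_⟩, Equiv.swap_apply_left _ _, fun _ => Equiv.swap_apply_of_ne_of_ne⟩
  intro x y
  rw [hswap, G.adj_comm, hswap, G.adj_comm]

variable {u v : W}

theorem IsAdmissibleWeighting.exists_iso_doubleSubdivision (φ : G ≃g doubleSubdivision H u v)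
    (hw : IsAdmissibleWeighting G c w) : ∃ ψ : doubleSubdivision H u v ≃g G,
      (w (s(.inl u, .inr 0).map ψ)).1 = 0 ∧ (w (s(.inl v, .inr 0).map ψ)).1 = 0 := by
  obtain ⟨z, hz, hu, hv⟩ := (hw.comp_map φ.symm).exists_bridge _ _
    not_preconnected_induce_compl_doubleSubdivision
  obtain ⟨σ, hσ, hfix⟩ :=
    exists_iso_apply_eq_of_neighborSet_eq ((neighborSet_doubleSubdivision_inr 0).trans hz.symm)
  have hadj {a : W ⊕ Fin 2} (ha : a ∈ ({.inl u, .inl v} : Set (W ⊕ Fin 2))) : a ≠ z :=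
    fun h => (doubleSubdivision H u v).loopless.irrefl z (by
      rw [← SimpleGraph.mem_neighborSet, hz, ← h]; exact ha)
  refine ⟨σ.trans φ.symm, ?_, ?_⟩
  · simpa [hσ, hfix _ Sum.inl_ne_inr (hadj (.inl rfl))] using hu
  · simpa [hσ, hfix _ Sum.inl_ne_inr (hadj (.inr rfl))] using hv

theorem exists_neighborSet_eq_pair_of_doubleSubdivision (hH : IsGeneralisedTriangle H)
    (huv : H.Adj u v) {x y : W} (hxy : ¬(H.induce {x, y}ᶜ).Preconnected) {z : W ⊕ Fin 2}
    (hz : (doubleSubdivision H u v).neighborSet z = {.inl x, .inl y}) :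
    ∃ z' ∉ s(u, v), z = .inl z' ∧ H.neighborSet z' = {x, y} := by
  rcases z with z | i
  · have hzuv : z ∉ s(u, v) := fun h => by
      have : Sum.inr 0 ∈ (doubleSubdivision H u v).neighborSet (.inl z) := Sym2.mem_iff.1 h
      simp [hz] at this
    refine ⟨z, hzuv, rfl, ?_⟩
    ext a
    have hadj : (doubleSubdivision H u v).Adj (.inl z) (.inl a) ↔ H.Adj z a :=
      and_iff_left fun h => hzuv (h ▸ Sym2.mem_mk_left z a)
    rw [SimpleGraph.mem_neighborSet, ← hadj, ← SimpleGraph.mem_neighborSet, hz]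
    simp
  · rw [neighborSet_doubleSubdivision_inr, ← Set.image_pair, ← Set.image_pair,
      Sum.inl_injective.image_injective.eq_iff] at hz
    exact absurd (hH.preconnected_induce_compl (hz ▸ SimpleGraph.isClique_pair.2 fun _ => huv)) hxy

theorem IsAdmissibleWeighting.contractWeights {t : ℝ} {w : Sym2 (W ⊕ Fin 2) → ℝ × ℝ}
    (hc : IsRatioBound t c) (hH : IsGeneralisedTriangle H) (huv : H.Adj u v)
    (hw : IsAdmissibleWeighting (doubleSubdivision H u v) c w)
    (hu : (w s(.inl u, .inr 0)).1 = 0) (hv : (w s(.inl v, .inr 0)).1 = 0) :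
    IsAdmissibleWeighting H c (contractWeights t u v w) where
  admissible e he := by
    by_cases heuv : e = s(u, v)
    · rw [heuv, contractWeights_self, Fin.prod_univ_two]
      have hadmu (i : Fin 2) : Admissible c (w s(.inl u, .inr i)) := hw.admissible _ (.inl rfl)
      have hadmv (i : Fin 2) : Admissible c (w s(.inl v, .inr i)) := hw.admissible _ (.inr rfl)
      exact hc.admissible_mul_seriesWeight (hadmu 1) (hadmv 1) (hadmu 0) (hadmv 0) hu hv
    · rw [contractWeights_of_ne t w heuv]
      refine hw.admissible _ ?_
      induction e using Sym2.ind
      exact ⟨he, heuv⟩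
  exists_bridge x y hxy := by
    have hsep := mt (preconnected_induce_compl_of_doubleSubdivision huv) hxy
    rw [Set.image_pair] at hsep
    obtain ⟨_, hz, hx, hy⟩ := hw.exists_bridge _ _ hsep
    obtain ⟨z, hzuv, rfl, hzxy⟩ := exists_neighborSet_eq_pair_of_doubleSubdivision hH huv hxy hz
    have hne (a : W) : s(a, z) ≠ s(u, v) := fun h => hzuv (h ▸ Sym2.mem_mk_right a z)
    refine ⟨z, hzxy, ?_, ?_⟩
    · rwa [contractWeights_of_ne t w (hne x)]
    · rwa [contractWeights_of_ne t w (hne y)]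

end Weighting

section Interpolation

variable {R : Type*} [CommRing R] {V W : Type*} {G : SimpleGraph V} {H : SimpleGraph W}
  {w : Sym2 V → R[X] × R[X]} {p : R[X]}

/-- Evaluation at `r` of a weight with polynomial components. -/
noncomputable def evalWeight (r : R) : R[X] × R[X] →+* R × R :=
  (evalRingHom r).prodMap (evalRingHom r)

theorem evalWeight_zero_one (r : R) : evalWeight r (0, 1) = (0, 1) := by
  simp [evalWeight]

/-- The polynomial `p` is the colour sum of `G` as a function of the number of colours, where the
weights may themselves depend polynomially on that number. -/
def Interpolates (G : SimpleGraph V) (w : Sym2 V → R[X] × R[X]) (p : R[X]) : Prop :=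
  ∀ n : ℕ, p.eval (n : R) = colorSum G (Fin n) (evalWeight (n : R) ∘ w)

theorem Interpolates.comp_map (φ : H ≃g G) (h : Interpolates G w p) :
    Interpolates H (w ∘ Sym2.map φ) p := fun n => by
  rw [← Function.comp_assoc, colorSum_comp_map, h n]

theorem evalWeight_comp_contractWeights (r : R) (u v : V) (w : Sym2 (V ⊕ Fin 2) → R[X] × R[X]) :
    evalWeight r ∘ contractWeights X u v w = contractWeights r u v (evalWeight r ∘ w) := by
  simpa only [evalWeight, coe_evalRingHom, eval_X] using
    map_contractWeights (evalRingHom r) X u v w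

theorem Interpolates.contractWeights [Finite V] {u v : V} {w : Sym2 (V ⊕ Fin 2) → R[X] × R[X]}
    (huv : G.Adj u v) (h : Interpolates (doubleSubdivision G u v) w p) :
    Interpolates G (contractWeights X u v w) p := fun n => by
  rw [h n, colorSum_doubleSubdivision huv, evalWeight_comp_contractWeights, Nat.card_fin]

theorem eval_edgeSum_mul_seriesWeight (r : R) (x y z : R[X] × R[X]) :
    (edgeSum X (x * seriesWeight X y z)).eval r =
      edgeSum r (evalWeight r x * seriesWeight r (evalWeight r y) (evalWeight r z)) := by
  rw [← coe_evalRingHom, map_edgeSum, map_mul, map_seriesWeight, coe_evalRingHom, eval_X]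
  rfl

theorem Interpolates.eq_edgeSum_of_top_fin_three [IsDomain R] [CharZero R]
    {w : Sym2 (Fin 3) → R[X] × R[X]} (h : Interpolates ⊤ w p) :
    p = edgeSum X (w s(0, 1) * seriesWeight X (w s(0, 2)) (w s(1, 2))) := by
  refine eq_of_infinite_eval_eq _ _
    ((Set.infinite_range_of_injective Nat.cast_injective).mono ?_)
  rintro _ ⟨n, rfl⟩
  rw [Set.mem_ofPred_eq, h n, colorSum_top_fin_three, Nat.card_fin,
    eval_edgeSum_mul_seriesWeight]
  rfl

theorem interpolates_chromaticPolynomial [Finite V] (G : SimpleGraph V) :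
    Interpolates G (fun _ => (0, 1)) ((chromaticPolynomial G).map (Int.castRingHom R)) := by
  intro n
  have hw : evalWeight (n : R) ∘ (fun _ : Sym2 V => (0, 1)) = fun _ => (0, 1) :=
    funext fun _ => evalWeight_zero_one _
  rw [eval_natCast_map, chromaticPolynomial_eval_natCast, hw, colorSum_zero_one, eq_intCast,
    Int.cast_natCast]

end Interpolation

theorem IsGeneralisedTriangle.neg_one_pow_card_mul_eval_pos {V : Type*} {G : SimpleGraph V}
    (hG : IsGeneralisedTriangle G) {t c : ℝ} (hc : IsRatioBound t c)
    {w : Sym2 V → ℝ[X] × ℝ[X]} {p : ℝ[X]} (hp : Interpolates G w p)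
    (hw : IsAdmissibleWeighting G c (evalWeight t ∘ w)) :
    0 < (-1) ^ Nat.card V * p.eval t := by
  induction hG with
  | triangle G h =>
    obtain ⟨φ⟩ := h
    have hadm {i j : Fin 3} (hij : i ≠ j) : Admissible c (evalWeight t (w (s(i, j).map φ.symm))) :=
      (hw.comp_map φ.symm).admissible s(i, j) hij
    have hneg := hc.edgeSum_mul_seriesWeight_neg (hadm (show 0 ≠ 1 by decide))
      (hadm (show 0 ≠ 2 by decide)) (hadm (show 1 ≠ 2 by decide))
    rw [(hp.comp_map φ.symm).eq_edgeSum_of_top_fin_three, eval_edgeSum_mul_seriesWeight,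
      Nat.card_congr φ.toEquiv, Nat.card_fin, Odd.neg_one_pow (by decide), neg_one_mul]
    exact neg_pos.2 hneg
  | subdivide H G u v hH huv h ih =>
    obtain ⟨φ⟩ := h
    have := hH.finite
    obtain ⟨ψ, hu, hv⟩ := hw.exists_iso_doubleSubdivision φ
    have hcontract := (hw.comp_map ψ).contractWeights hc hH huv hu hv
    rw [Function.comp_assoc, ← evalWeight_comp_contractWeights] at hcontract
    have hpos := ih ((hp.comp_map ψ).contractWeights huv) hcontract
    rwa [Nat.card_congr φ.toEquiv, Nat.card_sum, Nat.card_fin, pow_add, neg_one_sq, mul_one]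

end GenTriangle

theorem lemma17 {V : Type*} [Finite V] (G : SimpleGraph V) (hG : GenTriangle.ClassK2 G)
    (t : ℝ) (ht : t ∈ Set.Ioc (1 : ℝ) GenTriangle.q) :
    0 < (-1 : ℝ) ^ Nat.card V * Polynomial.aeval t (GenTriangle.chromaticPolynomial G) := by
  have hc := GenTriangle.isRatioBound_of_mem_Ioc ht
  have hw : GenTriangle.IsAdmissibleWeighting G ((t - 1) / √(3 - t))
      (GenTriangle.evalWeight t ∘ fun _ => (0, 1)) := by
    simpa only [Function.comp_def, GenTriangle.evalWeight_zero_one] using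
      hG.isAdmissibleWeighting_zero_one hc.pos.le
  rw [Polynomial.aeval_def, ← Polynomial.eval_map]
  exact hG.1.neg_one_pow_card_mul_eval_pos hc (GenTriangle.interpolates_chromaticPolynomial G) hw
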